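/- Let $n$ agents communicate over an undirected connected weighted graph with weights $a_{ij}=a_{ji}\ge 0$ (there is an edge between $i$ and $j$ iff $a_{ij}>0$), and let $L=\mathrm{diag}\big(\sum_j a_{1j},\dots,\sum_j a_{nj}\big)-[a_{ij}]$ be its Laplacian. For each agent $i$ let $f_i:\mathbb{R}^{d_i}\to\mathbb{R}$ be convex and differentiable with locally Lipschitz gradient, and let $A_i\in\mathbb{R}^{p\times d_i}$. Let $b\in\mathbb{R}^p$ and $b_1,\dots,b_n\in\mathbb{R}^p$ with $\sum_{i=1}^n b_i=b$. Assume that the problem $$\min_{x_i\in\mathbb{R}^{d_i}}\ \sum_{i=1}^n f_i(x_i)\quad\text{s.t.}\quad \sum_{i=1}^n A_ix_i=b \qquad (\mathrm{P})$$ has at least one optimal solution. Let $\alpha,\beta>0$ and consider the dynamics (IDEA), for $i=1,\dots,n$: $$\dot x_i=-\alpha\big(\nabla f_i(x_i)+A_i^\top\lambda_i\big)-A_i^\top(A_ix_i-b_i-z_i),$$ $$\dot\lambda_i=A_ix_i-b_i-z_i-\beta\sum_{j=1}^n L_{ij}\lambda_j,\qquad \dot z_i=\alpha\beta\sum_{j=1}^n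 L_{ij}\lambda_j,$$ with $x_i(t)\in\mathbb{R}^{d_i}$ and $\lambda_i(t),z_i(t)\in\mathbb{R}^p$. Then for every initial state $(x(0),\lambda(0),z(0))$ with $\sum_{i=1}^n z_i(0)=0$, a trajectory of IDEA from it exists on $[0,\infty)$, and every such trajectory $(x(t),\lambda(t),z(t))$ converges, as $t\to\infty$, to an equilibrium point $(x^*,\lambda^*,z^*)$ of IDEA for which $x^*$ is an optimal solution of (P). -/

import Mathlib

open Filter Topology

noncomputable section

/-- The Euclidean space `ℝᵐ`. -/
abbrev Euc (m : ℕ) : Type := EuclideanSpace ℝ (Fin m)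

/-- A weighted digraph on the agents `Fin n`, given by its weighted adjacency matrix `[a i j]`.
There is an edge `(i, j)` (agent `i` receives information from agent `j`) exactly when
`0 < a i j`, and `a i j = 0` otherwise. Diagonal weights are arbitrary: they cancel in the
Laplacian. -/
structure WeightedDigraph (n : ℕ) where
  /-- The weighted adjacency matrix. -/
  weight : Matrix (Fin n) (Fin n) ℝ
  weight_nonneg : ∀ i j, 0 ≤ weight i j

namespace WeightedDigraph

variable {n : ℕ}

/-- The edge relation. -/
def IsEdge (G : WeightedDigraph n) (i j : Fin n) : Prop := 0 < G.weight i j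

/-- The graph is undirected: the weights are symmetric. -/
def Undirected (G : WeightedDigraph n) : Prop := ∀ i j, G.weight i j = G.weight j i

/-- Any two agents are joined by a directed path. -/
def StronglyConnected (G : WeightedDigraph n) : Prop :=
  ∀ i j, Relation.ReflTransGen G.IsEdge i j

/-- The Laplacian `L = D - [a i j]`, with `D` the diagonal matrix of the row sums of `[a i j]`. -/
def laplacian (G : WeightedDigraph n) : Matrix (Fin n) (Fin n) ℝ :=
  Matrix.diagonal (fun i => ∑ j, G.weight i j) - G.weight

end WeightedDigraph

/-- The data of the problem `min ∑ i, f i (x i)` subject to `∑ i, A i * x i = b`, where agent `i`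
decides `x i ∈ ℝ^(d i)`, without local constraint sets. -/
structure CoupledProblem (n p : ℕ) (d : Fin n → ℕ) where
  /-- The local cost functions. -/
  f : ∀ i, Euc (d i) → ℝ
  /-- The local constraint matrices. -/
  A : ∀ i, Matrix (Fin p) (Fin (d i)) ℝ
  /-- The right-hand side of the coupled constraint. -/
  b : Euc p

/-- The stacked states `(x, lam, z) ∈ ℝ^(∑ d i) × ℝ^(n p) × ℝ^(n p)`, split into agents. -/
abbrev IDEAState (n p : ℕ) (d : Fin n → ℕ) : Type :=
  (∀ i : Fin n, Euc (d i)) × (Fin n → Euc p) × (Fin n → Euc p)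

namespace CoupledProblem

variable {n p : ℕ} {d : Fin n → ℕ}

/-- The global cost `f x = ∑ i, f i (x i)`. -/
def cost (P : CoupledProblem n p d) (x : ∀ i, Euc (d i)) : ℝ := ∑ i, P.f i (x i)

/-- The coupled constraint `∑ i, A i * x i = b`. -/
def Feasible (P : CoupledProblem n p d) (x : ∀ i, Euc (d i)) : Prop :=
  ∑ i, (P.A i).toEuclideanLin (x i) = P.b

/-- `x` is an optimal solution: a feasible point of least cost. -/
def IsOptimal (P : CoupledProblem n p d) (x : ∀ i, Euc (d i)) : Prop :=
  P.Feasible x ∧ ∀ y, P.Feasible y → P.cost x ≤ P.cost y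

/-- The vector field of IDEA, where `bs i` is agent `i`'s share of `b`. In the component of agent
`i`, with `r i = A i * x i - bs i - z i` and `(L lam) i = ∑ j, L i j • lam j`:
* `x i' = -α (∇ (f i) (x i) + (A i)ᵀ * lam i) - (A i)ᵀ * r i`,
* `lam i' = r i - β (L lam) i`,
* `z i' = α β (L lam) i`. -/
def ideaField (P : CoupledProblem n p d) (G : WeightedDigraph n) (bs : Fin n → Euc p)
    (α β : ℝ) : IDEAState n p d → IDEAState n p d :=
  fun (x, lam, z) =>
    (fun i =>
        -(α • (gradient (P.f i) (x i) + (P.A i).transpose.toEuclideanLin (lam i)))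
          - (P.A i).transpose.toEuclideanLin ((P.A i).toEuclideanLin (x i) - bs i - z i),
     fun i =>
        (P.A i).toEuclideanLin (x i) - bs i - z i - β • ∑ j, G.laplacian i j • lam j,
     fun i => (α * β) • ∑ j, G.laplacian i j • lam j)

/-- `s` is a trajectory of IDEA on `[0, ∞)`. -/
def IsTrajectory (P : CoupledProblem n p d) (G : WeightedDigraph n) (bs : Fin n → Euc p)
    (α β : ℝ) (s : ℝ → IDEAState n p d) : Prop :=
  ∀ t, 0 ≤ t → HasDerivWithinAt s (P.ideaField G bs α β (s t)) (Set.Ici 0) t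

/-- `e` is an equilibrium point of IDEA. -/
def IsEquilibrium (P : CoupledProblem n p d) (G : WeightedDigraph n) (bs : Fin n → Euc p)
    (α β : ℝ) (e : IDEAState n p d) : Prop :=
  P.ideaField G bs α β e = 0

end CoupledProblem

end

/-! Stack the agents: with `g` the stacked gradient, `A` block diagonal and `L` the Laplacian acting
on stacked vectors, IDEA becomes the single system described by `PrimalDualSystem`. An optimal
solution has a Lagrange multiplier μ, and taking λ_i = μ, z_i = A_i x_i - b_i gives an equilibrium e
with ∑ z_i = 0 (`IsOptimal.exists_field_eq_zero`).

On a connected undirected graph the range of L is the space of stacked vectors with zero sum, so z -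
z_e starts in range L, and it stays there because z' is in range L. With Q a generalized inverse of
L, the function V_e = ½|x - x_e|² + |α(λ - λ_e) + (z - z_e)|²/(2α) + ⟨Q(z - z_e), z - z_e⟩/(2β)
controls the distance to e and decreases at rate α⟨g x - g x_e, x - x_e⟩ + |r|², r being the
residual (`hasDerivWithinAt_lyapunov`). Trajectories are therefore bounded. Multiplying the field by
a nonnegative cutoff does not destroy this decrease, which yields global existence
(`exists_solution`).

The dissipation may vanish away from equilibria. A strict Lyapunov function replaces the invariance
principle: where the dissipation is zero, ⟨r, λ - λ_e⟩ decreases strictly unless the point is an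
equilibrium (`crossRate_pos`). By compactness K V_e + ⟨r, λ - λ_e⟩ decreases at a uniform rate as
long as the field is not small, so the field gets arbitrarily small at arbitrarily late times
(`exists_norm_field_lt`). A limit point e' along such times is an equilibrium. The function V_{e'}
is also nonincreasing and tends to 0 along a subsequence, so the whole trajectory converges to e'.
Finally e' inherits ∑ z_i = 0, so its residual equation gives feasibility, and L λ = 0 makes the
multipliers agree: these are the KKT conditions, sufficient by convexity. -/

/-! ### Global solutions of ordinary differential equations, and cutoffs -/

/-- A locally Lipschitz bounded vector field has a solution on `[0, ∞)`. -/
theorem exists_hasDerivWithinAt_Ici_of_bounded {E : Type*} [NormedAddCommGroup E]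
    [NormedSpace ℝ E] [FiniteDimensional ℝ E] {F : E → E} (hF : LocallyLipschitz F) {M : ℝ}
    (hM : ∀ x, ‖F x‖ ≤ M) (x₀ : E) :
    ∃ s : ℝ → E, s 0 = x₀ ∧ ∀ t, 0 ≤ t → HasDerivWithinAt s (F (s t)) (Set.Ici 0) t := by
  have : CompleteSpace E := FiniteDimensional.complete ℝ E
  have : ProperSpace E := FiniteDimensional.proper ℝ E
  have hM0 : 0 ≤ M := (norm_nonneg _).trans (hM x₀)
  have hlip : ∀ R : ℝ, ∃ K, LipschitzOnWith K F (Metric.closedBall x₀ R) := fun R =>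
    hF.locallyLipschitzOn.exists_lipschitzOnWith_of_compact (isCompact_closedBall x₀ R)
  have hloc : ∀ k : ℕ, ∃ u : ℝ → E, u 0 = x₀ ∧
      ∀ t ∈ Set.Icc (0 : ℝ) k, HasDerivWithinAt u (F (u t)) (Set.Icc 0 k) t := by
    intro k
    -- At speed at most M, a solution cannot leave the ball of radius M * k by time k.
    obtain ⟨K, hK⟩ := hlip (M * k)
    have hpl : IsPicardLindelof (fun _ => F) (tmin := 0) (tmax := k)
        ⟨0, le_rfl, Nat.cast_nonneg k⟩ x₀ (M * k).toNNReal 0 M.toNNReal K :=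
      { lipschitzOnWith := fun _ _ => by rwa [Real.coe_toNNReal _ (by positivity)]
        continuousOn := fun _ _ => continuousOn_const
        norm_le := fun _ _ x _ => (hM x).trans (Real.le_coe_toNNReal M)
        mul_max_le := by
          rw [Real.coe_toNNReal _ hM0, Real.coe_toNNReal _ (by positivity)]
          simp }
    exact hpl.exists_eq_forall_mem_Icc_hasDerivWithinAt₀
  choose u hu0 hu using hloc
  have hright : ∀ k : ℕ, ∀ t ∈ Set.Ico (0 : ℝ) k,
      HasDerivWithinAt (u k) (F (u k t)) (Set.Ici t) t := fun k t ht =>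
    (hu k t ⟨ht.1, ht.2.le⟩).mono_of_mem_nhdsWithin
      (mem_of_superset (Icc_mem_nhdsGE ht.2) (Set.Icc_subset_Icc_left ht.1))
  have hcont : ∀ k : ℕ, ContinuousOn (u k) (Set.Icc (0 : ℝ) k) := fun k t ht =>
    (hu k t ht).continuousWithinAt
  have huniq : ∀ j k : ℕ, j ≤ k → Set.EqOn (u j) (u k) (Set.Icc (0 : ℝ) j) := by
    intro j k hjk
    have hjk' : (j : ℝ) ≤ k := by exact_mod_cast hjk
    have hsub : Set.Icc (0 : ℝ) j ⊆ Set.Icc (0 : ℝ) k := Set.Icc_subset_Icc_right hjk'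
    have hbdd : ∀ i : ℕ, ∃ R, ∀ t ∈ Set.Icc (0 : ℝ) i, u i t ∈ Metric.closedBall x₀ R := by
      intro i
      obtain ⟨R, hR⟩ := (isCompact_Icc.image_of_continuousOn (hcont i)).isBounded.subset_closedBall x₀
      exact ⟨R, fun t ht => hR ⟨t, ht, rfl⟩⟩
    obtain ⟨R₁, hR₁⟩ := hbdd j
    obtain ⟨R₂, hR₂⟩ := hbdd k
    obtain ⟨K, hK⟩ := hlip (max R₁ R₂)
    refine ODE_solution_unique_of_mem_Icc_right (v := fun _ => F)
      (s := fun _ => Metric.closedBall x₀ (max R₁ R₂)) (fun _ _ => hK) (hcont j) (hright j)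
      (fun t ht => ?_) ((hcont k).mono hsub)
      (fun t ht => hright k t ⟨ht.1, ht.2.trans_le hjk'⟩) (fun t ht => ?_) ?_
    · exact Metric.closedBall_subset_closedBall (le_max_left _ _) (hR₁ t ⟨ht.1, ht.2.le⟩)
    · exact Metric.closedBall_subset_closedBall (le_max_right _ _) (hR₂ t (hsub ⟨ht.1, ht.2.le⟩))
    · rw [hu0, hu0]
  have heq : ∀ (k : ℕ) (t : ℝ), 0 ≤ t → t ≤ k → u ⌈t⌉₊ t = u k t := fun k t h0 hk =>
    huniq _ _ (Nat.ceil_le.2 hk) ⟨h0, Nat.le_ceil t⟩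
  refine ⟨fun t => u ⌈t⌉₊ t, by simp [hu0], fun t ht => ?_⟩
  -- The inequality t < k must be strict: then the glued function equals the single piece `u k` on a
  -- whole neighbourhood of t in [0, ∞).
  obtain ⟨k, hk⟩ := exists_nat_gt t
  have hmem : Set.Icc (0 : ℝ) k ∈ 𝓝[Set.Ici 0] t := by
    rw [← Set.Ici_inter_Iic, Set.inter_comm]
    exact inter_mem_nhdsWithin _ (Iic_mem_nhds hk) |> fun h => by rwa [Set.inter_comm] at h
  have h := (hu k t ⟨ht, hk.le⟩).mono_of_mem_nhdsWithin hmem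
  have h' := h.congr_of_eventuallyEq (f₁ := fun t => u ⌈t⌉₊ t)
    (by filter_upwards [hmem] with r hr using heq k r hr.1 hr.2) (heq k t ht hk.le)
  have h0 := heq k t ht hk.le
  simpa only [h0] using h'

/-- The product of a locally Lipschitz scalar function and a locally Lipschitz vector field is
locally Lipschitz. -/
theorem LocallyLipschitz.smul_vectorField {X E : Type*} [PseudoMetricSpace X]
    [NormedAddCommGroup E] [NormedSpace ℝ E] {φ : X → ℝ} {F : X → E} (hφ : LocallyLipschitz φ)
    (hF : LocallyLipschitz F) : LocallyLipschitz fun x => φ x • F x := by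
  intro x
  obtain ⟨K₁, U₁, hU₁, h₁⟩ := hφ x
  obtain ⟨K₂, U₂, hU₂, h₂⟩ := hF x
  have hb₁ : {y | ‖φ y‖ < ‖φ x‖ + 1} ∈ 𝓝 x :=
    (hφ.continuous.norm.continuousAt).eventually_lt continuousAt_const (lt_add_one _)
  have hb₂ : {y | ‖F y‖ < ‖F x‖ + 1} ∈ 𝓝 x :=
    (hF.continuous.norm.continuousAt).eventually_lt continuousAt_const (lt_add_one _)
  refine ⟨(‖φ x‖ + 1).toNNReal * K₂ + K₁ * (‖F x‖ + 1).toNNReal,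
    (U₁ ∩ U₂) ∩ ({y | ‖φ y‖ < ‖φ x‖ + 1} ∩ {y | ‖F y‖ < ‖F x‖ + 1}),
    inter_mem (inter_mem hU₁ hU₂) (inter_mem hb₁ hb₂), ?_⟩
  refine LipschitzOnWith.of_dist_le_mul fun y hy z hz => ?_
  have e : φ y • F y - φ z • F z = φ y • (F y - F z) + (φ y - φ z) • F z := by
    rw [smul_sub, sub_smul]; abel
  have d₁ := h₁.dist_le_mul y hy.1.1 z hz.1.1
  have d₂ := h₂.dist_le_mul y hy.1.2 z hz.1.2
  rw [dist_eq_norm] at d₁ d₂ ⊢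
  rw [e]
  refine (norm_add_le _ _).trans ?_
  rw [norm_smul, norm_smul]
  have b₁ : ‖φ y‖ ≤ ‖φ x‖ + 1 := le_of_lt hy.2.1
  have b₂ : ‖F z‖ ≤ ‖F x‖ + 1 := le_of_lt hz.2.2
  calc _ ≤ (‖φ x‖ + 1) * (K₂ * dist y z) + (K₁ * dist y z) * (‖F x‖ + 1) := by gcongr
    _ = _ := by
      rw [NNReal.coe_add, NNReal.coe_mul, NNReal.coe_mul, Real.coe_toNNReal _ (by positivity),
        Real.coe_toNNReal _ (by positivity)]
      ring

/-- Rescaling a locally Lipschitz vector field by a cutoff function gives a globally solvable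
equation. -/
theorem exists_cutoff_solution {E : Type*} [NormedAddCommGroup E]
    [NormedSpace ℝ E] [FiniteDimensional ℝ E] {F : E → E} (hF : LocallyLipschitz F) (R : ℝ)
    (x₀ : E) :
    ∃ (φ : E → ℝ) (s : ℝ → E), (∀ x, 0 ≤ φ x) ∧ (∀ x, ‖x‖ ≤ R → φ x = 1) ∧ s 0 = x₀ ∧
      ∀ t, 0 ≤ t → HasDerivWithinAt s (φ (s t) • F (s t)) (Set.Ici 0) t := by
  have : ProperSpace E := FiniteDimensional.proper ℝ E
  let φ : E → ℝ := fun x => max 0 (min 1 (R + 1 - ‖x‖))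
  have hn : LipschitzWith 1 fun x : E => R + 1 - ‖x‖ := by
    refine LipschitzWith.of_dist_le_mul fun x y => ?_
    rw [Real.dist_eq, dist_eq_norm, NNReal.coe_one, one_mul, abs_sub_comm]
    convert abs_norm_sub_norm_le x y using 2
    ring
  have hφ : LocallyLipschitz φ := ((hn.const_min 1).const_max 0).locallyLipschitz
  have hφ0 : ∀ x, 0 ≤ φ x := fun x => le_max_left _ _
  have hφ1 : ∀ x, φ x ≤ 1 := fun x => max_le zero_le_one (min_le_left _ _)
  obtain ⟨M, hM⟩ := (isCompact_closedBall (0 : E) (R + 1)).exists_bound_of_continuousOn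
    hF.continuous.continuousOn
  have hbound : ∀ x, ‖φ x • F x‖ ≤ max M 0 := by
    intro x
    by_cases hx : ‖x‖ ≤ R + 1
    · rw [norm_smul, Real.norm_of_nonneg (hφ0 x)]
      calc _ ≤ 1 * ‖F x‖ := by gcongr; exact hφ1 x
        _ ≤ max M 0 := by rw [one_mul]; exact (hM x (by simpa using hx)).trans (le_max_left _ _)
    · have : φ x = 0 := max_eq_left ((min_le_right _ _).trans (by linarith))
      rw [this, zero_smul, norm_zero]
      exact le_max_right _ _
  obtain ⟨s, hs0, hs⟩ := exists_hasDerivWithinAt_Ici_of_bounded (hφ.smul_vectorField hF) hbound x₀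
  refine ⟨φ, s, hφ0, fun x hx => ?_, hs0, hs⟩
  have : min 1 (R + 1 - ‖x‖) = 1 := min_eq_left (by linarith)
  simp [φ, this]

/-! ### Compactness, monotonicity and generalized inverses -/

/-- If `a` is nonnegative and `c` is positive where `a` vanishes, then `K * a + c` is bounded below
by a positive constant on a compact set for some `K`. -/
theorem IsCompact.exists_pos_le_mul_add {X : Type*} [TopologicalSpace X] {C : Set X}
    (hC : IsCompact C) {a c : X → ℝ} (ha : Continuous a) (hc : Continuous c)
    (ha0 : ∀ x ∈ C, 0 ≤ a x) (hpos : ∀ x ∈ C, a x = 0 → 0 < c x) :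
    ∃ K δ : ℝ, 0 < δ ∧ ∀ x ∈ C, δ ≤ K * a x + c x := by
  -- Since `a` is nonnegative only on C, it is truncated at 0 so that these open sets increase with
  -- k everywhere.
  have hcover : C ⊆ ⋃ k : ℕ, {x | 0 < k * max (a x) 0 + c x} := by
    intro x hx
    rcases (ha0 x hx).eq_or_lt with h | h
    · exact Set.mem_iUnion.2 ⟨0, by simpa using hpos x hx h.symm⟩
    · obtain ⟨k, hk⟩ := exists_nat_gt (-c x / a x)
      refine Set.mem_iUnion.2 ⟨k, ?_⟩
      rw [div_lt_iff₀ h] at hk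
      simp only [Set.mem_ofPred_eq, max_eq_left h.le]
      linarith
  obtain ⟨k, hk⟩ := hC.elim_directed_cover (fun k : ℕ => {x | 0 < k * max (a x) 0 + c x})
    (fun k => isOpen_lt continuous_const
      ((continuous_const.mul (ha.max continuous_const)).add hc)) hcover
    (directed_of_isDirected_le fun i j hij x hx => by
      have hij' : (i : ℝ) ≤ j := by exact_mod_cast hij
      have : (i : ℝ) * max (a x) 0 ≤ j * max (a x) 0 :=
        mul_le_mul_of_nonneg_right hij' (le_max_right _ _)
      simp only [Set.mem_ofPred_eq] at hx ⊢
      linarith)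
  rcases C.eq_empty_or_nonempty with rfl | hne
  · exact ⟨0, 1, one_pos, by simp⟩
  obtain ⟨y, hy, hmin⟩ := hC.exists_isMinOn hne
    (f := fun x => (k : ℝ) * a x + c x) ((continuous_const.mul ha).add hc).continuousOn
  refine ⟨k, k * a y + c y, ?_, fun x hx => hmin hx⟩
  have := hk hy
  rwa [Set.mem_ofPred_eq, max_eq_left (ha0 y hy)] at this

noncomputable section

open scoped InnerProductSpace

theorem antitoneOn_Ici_of_hasDerivWithinAt_nonpos {f f' : ℝ → ℝ} {a : ℝ}
    (hf : ∀ t, a ≤ t → HasDerivWithinAt f (f' t) (Set.Ici a) t) (hf' : ∀ t, a ≤ t → f' t ≤ 0) :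
    AntitoneOn f (Set.Ici a) := by
  refine antitoneOn_of_hasDerivWithinAt_nonpos (f' := f') (convex_Ici a)
    (fun t ht => (hf t ht).continuousWithinAt) (fun t ht => ?_) (fun t ht => ?_)
  · exact (hf t (interior_subset ht)).mono interior_subset
  · exact hf' t (interior_subset ht)

/-- Extend a linear section of L over its range to the whole space. The resulting Q stands in for
the pseudo-inverse in the Lyapunov function; it need not be symmetric. -/
theorem LinearMap.exists_comp_comp_eq_self {H : Type*} [AddCommGroup H] [Module ℝ H]
    (L : H →ₗ[ℝ] H) : ∃ Q : H →ₗ[ℝ] H, ∀ x, L (Q (L x)) = L x := by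
  obtain ⟨q, hq⟩ := L.rangeRestrict.exists_rightInverse_of_surjective L.range_rangeRestrict
  obtain ⟨Q, hQ⟩ := q.exists_extend
  refine ⟨Q, fun x => ?_⟩
  have h₁ : Q (L x) = q (L.rangeRestrict x) := by rw [← hQ]; rfl
  have h₂ := congrArg Subtype.val (LinearMap.congr_fun hq (L.rangeRestrict x))
  rw [h₁]
  exact h₂

theorem HasDerivWithinAt.prodFst {V W : Type*} [NormedAddCommGroup V] [NormedSpace ℝ V]
    [NormedAddCommGroup W] [NormedSpace ℝ W] {s : ℝ → V × W} {s' : V × W} {D : Set ℝ} {t : ℝ}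
    (h : HasDerivWithinAt s s' D t) : HasDerivWithinAt (fun τ => (s τ).1) s'.1 D t :=
  (ContinuousLinearMap.fst ℝ V W).hasFDerivAt.comp_hasDerivWithinAt t h

theorem HasDerivWithinAt.prodSnd {V W : Type*} [NormedAddCommGroup V] [NormedSpace ℝ V]
    [NormedAddCommGroup W] [NormedSpace ℝ W] {s : ℝ → V × W} {s' : V × W} {D : Set ℝ} {t : ℝ}
    (h : HasDerivWithinAt s s' D t) : HasDerivWithinAt (fun τ => (s τ).2) s'.2 D t :=
  (ContinuousLinearMap.snd ℝ V W).hasFDerivAt.comp_hasDerivWithinAt t h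

/-! ### The abstract primal-dual system and its Lyapunov function -/

variable (E H : Type*) [NormedAddCommGroup E] [InnerProductSpace ℝ E] [NormedAddCommGroup H]
  [InnerProductSpace ℝ H]

/-- The data of the primal-dual dynamics
`x' = -α (g x + Aᵀ λ) - Aᵀ r`, `λ' = r - β L λ`, `z' = α β L λ` with `r = A x - b - z`, for a
monotone map `g` that is constant on the pairs where the monotonicity inequality is tight, and a
symmetric positive semidefinite `L`. -/
structure PrimalDualSystem where
  g : E → E
  A : E →L[ℝ] H
  L : H →L[ℝ] H
  b : H
  α : ℝ
  β : ℝ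
  locallyLipschitz_g : LocallyLipschitz g
  monotone_g : ∀ x y, 0 ≤ ⟪g x - g y, x - y⟫_ℝ
  eq_of_inner_eq_zero : ∀ x y, ⟪g x - g y, x - y⟫_ℝ = 0 → g x = g y
  symm_L : ∀ u v, ⟪L u, v⟫_ℝ = ⟪u, L v⟫_ℝ
  nonneg_L : ∀ u, 0 ≤ ⟪L u, u⟫_ℝ
  α_pos : 0 < α
  β_pos : 0 < β

variable {E H}

namespace PrimalDualSystem

variable (S : PrimalDualSystem E H)

/-- The constraint residual. -/
def residual (s : E × H × H) : H := S.A s.1 - S.b - s.2.2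

theorem continuous_residual : Continuous S.residual := by
  unfold residual
  fun_prop

/-- The dissipation rate of the Lyapunov functions. -/
def dissipation (e s : E × H × H) : ℝ :=
  S.α * ⟪S.g s.1 - S.g e.1, s.1 - e.1⟫_ℝ + ‖S.residual s‖ ^ 2

/-- The Lyapunov function attached to a point `e`, where `Q` is a generalized inverse of `L`. -/
def lyapunov (Q : H →L[ℝ] H) (e s : E × H × H) : ℝ :=
  2⁻¹ * ‖s.1 - e.1‖ ^ 2 + (2 * S.α)⁻¹ * ‖S.α • (s.2.1 - e.2.1) + (s.2.2 - e.2.2)‖ ^ 2 +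
    (2 * S.β)⁻¹ * ⟪Q (s.2.2 - e.2.2), s.2.2 - e.2.2⟫_ℝ

theorem dissipation_nonneg (e s : E × H × H) : 0 ≤ S.dissipation e s := by
  have h₁ := mul_nonneg S.α_pos.le (S.monotone_g s.1 e.1)
  unfold dissipation
  positivity

theorem continuous_dissipation (e : E × H × H) : Continuous (S.dissipation e) := by
  have h₁ := S.locallyLipschitz_g.continuous
  have h₂ := S.continuous_residual
  unfold dissipation
  fun_prop

theorem continuous_lyapunov (Q : H →L[ℝ] H) (e : E × H × H) : Continuous (S.lyapunov Q e) := by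
  unfold lyapunov
  fun_prop

theorem lyapunov_self (Q : H →L[ℝ] H) (e : E × H × H) : S.lyapunov Q e e = 0 := by
  simp [lyapunov]

theorem residual_sub_eq {e : E × H × H} (he : S.residual e = 0) (s : E × H × H) :
    S.residual s = S.A (s.1 - e.1) - (s.2.2 - e.2.2) := by
  have : S.residual s = S.residual s - S.residual e := by rw [he, sub_zero]
  rw [this]
  simp only [residual, map_sub]
  abel

/-- The quadratic form of a positive semidefinite `L` dominates `‖L y‖ ^ 2`. -/
theorem norm_L_sq_le (y : H) : ‖S.L y‖ ^ 2 ≤ (‖S.L‖ + 1) * ⟪S.L y, y⟫_ℝ := by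
  have hN : 0 < ‖S.L‖ + 1 := by positivity
  -- With c = (‖L‖ + 1)⁻¹, expanding ⟨L(y - c L y), y - c L y⟩ ≥ 0 gives c‖L y‖² ≤ ⟨L y, y⟩, since
  -- c⟨L L y, L y⟩ ≤ ‖L y‖². The + 1 covers L = 0.
  have h := S.nonneg_L (y - (‖S.L‖ + 1)⁻¹ • S.L y)
  have h₁ : ⟪S.L (S.L y), S.L y⟫_ℝ ≤ (‖S.L‖ + 1) * ‖S.L y‖ ^ 2 := by
    refine (real_inner_le_norm _ _).trans ?_
    have := S.L.le_opNorm (S.L y)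
    nlinarith [norm_nonneg (S.L y)]
  have h₂ : ⟪S.L (S.L y), y⟫_ℝ = ‖S.L y‖ ^ 2 := by
    rw [S.symm_L, real_inner_self_eq_norm_sq]
  simp only [map_sub, map_smul, inner_sub_left, inner_sub_right, inner_smul_left, inner_smul_right,
    real_inner_self_eq_norm_sq, h₂, conj_trivial] at h
  have h₃ : (‖S.L‖ + 1)⁻¹ * ((‖S.L‖ + 1)⁻¹ * ⟪S.L (S.L y), S.L y⟫_ℝ) ≤
      (‖S.L‖ + 1)⁻¹ * ‖S.L y‖ ^ 2 := by
    gcongr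
    rw [inv_mul_le_iff₀ hN]
    exact h₁
  have h₄ : (‖S.L‖ + 1)⁻¹ * ‖S.L y‖ ^ 2 ≤ ⟪S.L y, y⟫_ℝ := by linarith
  rwa [inv_mul_le_iff₀ hN] at h₄

/-- Write z for the last component of s - e. The condition z = L(Q z) turns ⟨Q z, z⟩ into the
quadratic form of L at Q z, which dominates ‖z‖². The multiplier component is then recovered from α
l + z. The constant depends on neither point. -/
theorem exists_norm_sub_le_sqrt_lyapunov (Q : H →L[ℝ] H) :
    ∃ D : ℝ, ∀ e s : E × H × H, S.L (Q (s.2.2 - e.2.2)) = s.2.2 - e.2.2 →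
      0 ≤ S.lyapunov Q e s ∧ ‖s - e‖ ≤ D * √(S.lyapunov Q e s) := by
  have hα := S.α_pos
  have hβ := S.β_pos
  let c₁ := √(2 * S.α)
  let c₂ := √((‖S.L‖ + 1) * (2 * S.β))
  refine ⟨max √2 (max (S.α⁻¹ * (c₁ + c₂)) c₂), fun e s h => ?_⟩
  set x := s.1 - e.1
  set l := s.2.1 - e.2.1
  set z := s.2.2 - e.2.2
  have hQ : ‖z‖ ^ 2 ≤ (‖S.L‖ + 1) * ⟪Q z, z⟫_ℝ := by
    have := S.norm_L_sq_le (Q z)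
    rwa [h, real_inner_comm] at this
  have hQ0 : 0 ≤ ⟪Q z, z⟫_ℝ := by
    have := S.nonneg_L (Q z)
    rwa [h, real_inner_comm] at this
  set V := S.lyapunov Q e s with hV
  have hVdef : V = 2⁻¹ * ‖x‖ ^ 2 + (2 * S.α)⁻¹ * ‖S.α • l + z‖ ^ 2 + (2 * S.β)⁻¹ * ⟪Q z, z⟫_ℝ := rfl
  have p₁ : 0 ≤ 2⁻¹ * ‖x‖ ^ 2 := by positivity
  have p₂ : 0 ≤ (2 * S.α)⁻¹ * ‖S.α • l + z‖ ^ 2 := by positivity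
  have p₃ : 0 ≤ (2 * S.β)⁻¹ * ⟪Q z, z⟫_ℝ := by positivity
  have hV0 : 0 ≤ V := by linarith
  have b₁ : ‖x‖ ≤ √2 * √V := by
    rw [← Real.sqrt_mul (by positivity)]
    exact Real.le_sqrt_of_sq_le (by linarith)
  have b₂ : ‖S.α • l + z‖ ≤ c₁ * √V := by
    rw [← Real.sqrt_mul (by positivity)]
    refine Real.le_sqrt_of_sq_le ?_
    rw [← inv_mul_le_iff₀ (by positivity)]
    linarith
  have b₃ : ‖z‖ ≤ c₂ * √V := by
    rw [← Real.sqrt_mul (by positivity), mul_assoc]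
    refine Real.le_sqrt_of_sq_le (hQ.trans ?_)
    gcongr
    rw [← inv_mul_le_iff₀ (by positivity)]
    linarith
  have b₄ : ‖l‖ ≤ S.α⁻¹ * (c₁ + c₂) * √V := by
    have e₁ : l = S.α⁻¹ • ((S.α • l + z) - z) := by
      rw [add_sub_cancel_right, smul_smul, inv_mul_cancel₀ hα.ne', one_smul]
    rw [e₁, norm_smul, Real.norm_of_nonneg (by positivity), mul_assoc]
    gcongr
    exact (norm_sub_le _ _).trans (by linarith)
  refine ⟨hV0, ?_⟩
  rw [Prod.norm_def, Prod.norm_def]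
  refine max_le (b₁.trans ?_) (max_le (b₄.trans ?_) (b₃.trans ?_))
  · gcongr; exact le_max_left _ _
  · gcongr; exact (le_max_left _ _).trans (le_max_right _ _)
  · gcongr; exact (le_max_right _ _).trans (le_max_right _ _)

variable [FiniteDimensional ℝ H]

theorem exists_generalizedInverse : ∃ Q : H →L[ℝ] H, ∀ u, S.L (Q (S.L u)) = S.L u := by
  obtain ⟨Q, hQ⟩ := LinearMap.exists_comp_comp_eq_self S.L.toLinearMap
  exact ⟨LinearMap.toContinuousLinearMap Q, hQ⟩

variable [FiniteDimensional ℝ E]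

/-- The transpose of the constraint map. -/
def At : H →L[ℝ] E :=
  haveI : CompleteSpace E := FiniteDimensional.complete ℝ E
  haveI : CompleteSpace H := FiniteDimensional.complete ℝ H
  ContinuousLinearMap.adjoint S.A

theorem inner_At_right (x : E) (v : H) : ⟪x, S.At v⟫_ℝ = ⟪S.A x, v⟫_ℝ := by
  have : CompleteSpace E := FiniteDimensional.complete ℝ E
  have : CompleteSpace H := FiniteDimensional.complete ℝ H
  exact ContinuousLinearMap.adjoint_inner_right S.A x v

/-- The vector field of the dynamics. -/
def field (s : E × H × H) : E × H × H :=
  (-(S.α • (S.g s.1 + S.At s.2.1)) - S.At (S.residual s),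
    S.residual s - S.β • S.L s.2.1, (S.α * S.β) • S.L s.2.1)

theorem locallyLipschitz_field : LocallyLipschitz S.field := by
  have hg : LocallyLipschitz fun s : E × H × H =>
      ContinuousLinearMap.inl ℝ E (H × H) (-(S.α • S.g s.1)) :=
    ((ContinuousLinearMap.inl ℝ E (H × H)).comp
      (-(S.α • ContinuousLinearMap.id ℝ E))).lipschitz.locallyLipschitz.comp
      (S.locallyLipschitz_g.comp LipschitzWith.prod_fst.locallyLipschitz)
  have haff : ContDiff ℝ 1 fun s : E × H × H =>
      (-(S.α • S.At s.2.1) - S.At (S.residual s),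
        S.residual s - S.β • S.L s.2.1, (S.α * S.β) • S.L s.2.1) := by
    unfold residual
    fun_prop
  suffices heq : S.field = (fun s : E × H × H =>
      ContinuousLinearMap.inl ℝ E (H × H) (-(S.α • S.g s.1))) + fun s : E × H × H =>
      (-(S.α • S.At s.2.1) - S.At (S.residual s),
        S.residual s - S.β • S.L s.2.1, (S.α * S.β) • S.L s.2.1) by
    rw [heq]
    exact hg.add haff.locallyLipschitz
  funext s
  refine Prod.ext ?_ (Prod.ext ?_ ?_)
  · simp only [field, Pi.add_apply, ContinuousLinearMap.inl_apply, Prod.mk_add_mk]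
    module
  · simp [field]
  · simp [field]

theorem continuous_field : Continuous S.field := S.locallyLipschitz_field.continuous

theorem field_eq_zero_iff (e : E × H × H) :
    S.field e = 0 ↔ S.g e.1 + S.At e.2.1 = 0 ∧ S.residual e = 0 ∧ S.L e.2.1 = 0 := by
  have hα := S.α_pos.ne'
  have hβ := S.β_pos.ne'
  constructor
  · intro h
    have h₁ := congrArg Prod.fst h
    have h₂ := congrArg (fun s => s.2.1) h
    have h₃ := congrArg (fun s => s.2.2) h
    simp only [field, Prod.fst_zero, Prod.snd_zero] at h₁ h₂ h₃
    have hL : S.L e.2.1 = 0 := by simpa [hα, hβ] using h₃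
    have hr : S.residual e = 0 := by simpa [hL] using h₂
    refine ⟨?_, hr, hL⟩
    rw [hr, map_zero, sub_zero, neg_eq_zero] at h₁
    exact (smul_eq_zero.1 h₁).resolve_left hα
  · rintro ⟨h₁, h₂, h₃⟩
    simp [field, h₁, h₂, h₃]

/-- The three terms of the function are weighted so that all indefinite cross terms cancel, using
A(x - x_e) = r + (z - z_e). The scalar c makes the computation valid for the dynamics slowed down by
a cutoff too. -/
theorem hasDerivWithinAt_lyapunov {Q : H →L[ℝ] H} (hQ : ∀ u, S.L (Q (S.L u)) = S.L u)
    {e : E × H × H} (he : S.field e = 0) {s : ℝ → E × H × H} {c t : ℝ} {D : Set ℝ}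
    (hs : HasDerivWithinAt s (c • S.field (s t)) D t)
    (hz : S.L (Q ((s t).2.2 - e.2.2)) = (s t).2.2 - e.2.2) :
    HasDerivWithinAt (fun τ => S.lyapunov Q e (s τ)) (-(c * S.dissipation e (s t))) D t := by
  obtain ⟨heg, her, heL⟩ := (S.field_eq_zero_iff e).1 he
  have hα := S.α_pos.ne'
  have hβ := S.β_pos.ne'
  have hx := hs.prodFst.sub_const e.1
  have hl := hs.prodSnd.prodFst.sub_const e.2.1
  have hz' := hs.prodSnd.prodSnd.sub_const e.2.2
  have hw : HasDerivWithinAt (fun τ => S.α • ((s τ).2.1 - e.2.1) + ((s τ).2.2 - e.2.2))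
      _ D t := (hl.const_smul S.α).add hz'
  have hq : HasDerivWithinAt (fun τ => ⟪Q ((s τ).2.2 - e.2.2), (s τ).2.2 - e.2.2⟫_ℝ)
      (⟪Q ((s t).2.2 - e.2.2), (c • S.field (s t)).2.2⟫_ℝ +
        ⟪Q (c • S.field (s t)).2.2, (s t).2.2 - e.2.2⟫_ℝ) D t :=
    (Q.hasFDerivAt.comp_hasDerivWithinAt t hz').inner ℝ hz'
  have key := ((hx.norm_sq.const_mul (2⁻¹ : ℝ)).add (hw.norm_sq.const_mul (2 * S.α)⁻¹)).add
    (hq.const_mul (2 * S.β)⁻¹)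
  refine key.congr_deriv ?_
  have hr := S.residual_sub_eq her (s t)
  set r := S.residual (s t) with hrdef
  have hg : S.g (s t).1 + S.At (s t).2.1 =
      (S.g (s t).1 - S.g e.1) + S.At ((s t).2.1 - e.2.1) := by
    rw [map_sub, eq_neg_of_add_eq_zero_left heg]; abel
  have hL : S.L (s t).2.1 = S.L ((s t).2.1 - e.2.1) := by rw [map_sub, heL, sub_zero]
  have hf : S.field (s t) = (-(S.α • ((S.g (s t).1 - S.g e.1) + S.At ((s t).2.1 - e.2.1)))
      - S.At r, r - S.β • S.L ((s t).2.1 - e.2.1),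
      (S.α * S.β) • S.L ((s t).2.1 - e.2.1)) := by
    simp only [field, hg, hL, ← hrdef]
  simp only [hf, dissipation, Prod.smul_mk, ← hrdef]
  set x := (s t).1 - e.1
  set l := (s t).2.1 - e.2.1
  set z := (s t).2.2 - e.2.2
  set γ := S.g (s t).1 - S.g e.1
  have hA : S.A x = r + z := by rw [hr]; abel
  -- Q is not symmetric, but L is, and on range L the identity L Q = 1 makes both halves of the
  -- derivative of ⟨Q z, z⟩ equal.
  have q₁ : ⟪Q z, S.L l⟫_ℝ = ⟪z, l⟫_ℝ := by rw [← S.symm_L, hz]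
  have q₂ : ⟪Q (S.L l), z⟫_ℝ = ⟪l, z⟫_ℝ := by
    conv_lhs => rw [← hz]
    rw [← S.symm_L, hQ, S.symm_L, hz]
  -- The combination α λ + z is chosen because its derivative is free of L λ.
  have hαl : S.α • (c • (r - S.β • S.L l)) + c • (S.α * S.β) • S.L l = (c * S.α) • r := by
    module
  simp only [hαl]
  simp only [inner_smul_right, inner_smul_left, inner_add_left, inner_add_right, inner_sub_right,
    inner_neg_right, map_smul, q₁, q₂, inner_At_right, hA, conj_trivial, real_inner_self_eq_norm_sq,
    real_inner_comm x γ, real_inner_comm z l, real_inner_comm l r]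
  field_simp
  ring

/-- Along a trajectory `z` moves within the range of `L`. -/
theorem sub_mem_range_of_trajectory {Q : H →L[ℝ] H} (hQ : ∀ u, S.L (Q (S.L u)) = S.L u)
    (w : H) {s : ℝ → E × H × H} {c : ℝ → ℝ}
    (hs : ∀ t, 0 ≤ t → HasDerivWithinAt s (c t • S.field (s t)) (Set.Ici 0) t)
    (h0 : S.L (Q ((s 0).2.2 - w)) = (s 0).2.2 - w) :
    ∀ t, 0 ≤ t → S.L (Q ((s t).2.2 - w)) = (s t).2.2 - w := by
  intro T hT
  have hd : ∀ t, 0 ≤ t → HasDerivWithinAt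
      (fun τ => S.L (Q ((s τ).2.2 - w)) - ((s τ).2.2 - w)) 0 (Set.Ici 0) t := by
    intro t ht
    have hz := (hs t ht).prodSnd.prodSnd.sub_const w
    have h := ((S.L.comp Q).hasFDerivAt.comp_hasDerivWithinAt t hz).sub hz
    refine h.congr_deriv ?_
    simp [field, hQ]
  have := constant_of_has_deriv_right_zero (a := 0) (b := T)
    (fun t ht => ((hd t ht.1).continuousWithinAt).mono Set.Icc_subset_Ici_self)
    (fun t ht => (hd t ht.1).mono (Set.Ici_subset_Ici.2 ht.1)) T ⟨hT, le_rfl⟩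
  rw [h0, sub_self] at this
  exact sub_eq_zero.1 this

theorem antitoneOn_lyapunov {Q : H →L[ℝ] H} (hQ : ∀ u, S.L (Q (S.L u)) = S.L u)
    {e : E × H × H} (he : S.field e = 0) {s : ℝ → E × H × H} {c : ℝ → ℝ} (hc : ∀ t, 0 ≤ c t)
    (hs : ∀ t, 0 ≤ t → HasDerivWithinAt s (c t • S.field (s t)) (Set.Ici 0) t)
    (h0 : S.L (Q ((s 0).2.2 - e.2.2)) = (s 0).2.2 - e.2.2) :
    AntitoneOn (fun t => S.lyapunov Q e (s t)) (Set.Ici 0) :=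
  antitoneOn_Ici_of_hasDerivWithinAt_nonpos
    (fun t ht => S.hasDerivWithinAt_lyapunov hQ he (hs t ht)
      (S.sub_mem_range_of_trajectory hQ e.2.2 hs h0 t ht))
    (fun t _ => neg_nonpos.2 (mul_nonneg (hc t) (S.dissipation_nonneg e _)))

/-! ### A strict Lyapunov function and convergence -/

/-- The rate of decrease of `⟪r, λ - λ_e⟫` along the dynamics. -/
def crossRate (e s : E × H × H) : ℝ :=
  -(⟪S.residual s, (S.field s).2.1⟫_ℝ +
    ⟪S.A (S.field s).1 - (S.field s).2.2, s.2.1 - e.2.1⟫_ℝ)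

theorem continuous_crossRate (e : E × H × H) : Continuous (S.crossRate e) := by
  have h₁ := S.continuous_residual
  have hx : Continuous fun s => (S.field s).1 := S.continuous_field.fst
  have hl : Continuous fun s => (S.field s).2.1 := S.continuous_field.snd.fst
  have hz : Continuous fun s => (S.field s).2.2 := S.continuous_field.snd.snd
  have hA : Continuous fun s => S.A (S.field s).1 := S.A.continuous.comp hx
  exact ((h₁.inner hl).add ((hA.sub hz).inner (by fun_prop))).neg

theorem hasDerivWithinAt_cross (e : E × H × H) {s : ℝ → E × H × H} {t : ℝ} {D : Set ℝ}
    (hs : HasDerivWithinAt s (S.field (s t)) D t) :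
    HasDerivWithinAt (fun τ => ⟪S.residual (s τ), (s τ).2.1 - e.2.1⟫_ℝ)
      (-S.crossRate e (s t)) D t := by
  have hr := ((S.A.hasFDerivAt.comp_hasDerivWithinAt t hs.prodFst).sub_const S.b).sub hs.prodSnd.prodSnd
  have h := hr.inner ℝ (hs.prodSnd.prodFst.sub_const e.2.1)
  refine h.congr_deriv ?_
  simp [crossRate, residual]

/-- Zero dissipation forces r = 0 and g x = g x_e. With l = λ - λ_e the rate then reduces to α‖Aᵀ
l‖² + αβ⟨L l, l⟩, and both terms vanish only when Aᵀ l = 0 and L l = 0, that is, at an equilibrium.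
-/
theorem crossRate_pos {e s : E × H × H} (he : S.field e = 0) (hd : S.dissipation e s = 0)
    (hs : S.field s ≠ 0) : 0 < S.crossRate e s := by
  obtain ⟨heg, her, heL⟩ := (S.field_eq_zero_iff e).1 he
  have hα := S.α_pos
  have hβ := S.β_pos
  have h₁ := S.monotone_g s.1 e.1
  have h₂ : 0 ≤ S.α * ⟪S.g s.1 - S.g e.1, s.1 - e.1⟫_ℝ := mul_nonneg hα.le h₁
  have h₃ : 0 ≤ ‖S.residual s‖ ^ 2 := by positivity
  unfold dissipation at hd
  have hr : S.residual s = 0 := by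
    have : ‖S.residual s‖ ^ 2 = 0 := by linarith
    simpa using this
  have hg : S.g s.1 = S.g e.1 := by
    refine S.eq_of_inner_eq_zero _ _ ?_
    have : S.α * ⟪S.g s.1 - S.g e.1, s.1 - e.1⟫_ℝ = 0 := by linarith
    exact (mul_eq_zero.1 this).resolve_left hα.ne'
  set l := s.2.1 - e.2.1 with hl
  have hAt : S.g s.1 + S.At s.2.1 = S.At l := by
    rw [hg, eq_neg_of_add_eq_zero_left heg, hl, map_sub]; abel
  have hL : S.L s.2.1 = S.L l := by rw [hl, map_sub, heL, sub_zero]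
  have hval : S.crossRate e s = S.α * ‖S.At l‖ ^ 2 + S.α * S.β * ⟪S.L l, l⟫_ℝ := by
    have : ⟪S.A (S.At l), l⟫_ℝ = ‖S.At l‖ ^ 2 := by
      rw [← inner_At_right, real_inner_self_eq_norm_sq]
    simp only [crossRate, field, hr, hAt, hL, ← hl, map_zero, sub_zero, inner_zero_left, zero_add,
      inner_sub_left, map_neg, map_smul, inner_neg_left, inner_smul_left, this, conj_trivial]
    ring
  have hLl := S.nonneg_L l
  have hne : S.At l ≠ 0 ∨ S.L l ≠ 0 := by
    by_contra! hcon
    exact hs ((S.field_eq_zero_iff s).2 ⟨hAt.trans hcon.1, hr, hL.trans hcon.2⟩)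
  rw [hval]
  rcases hne with hne | hne
  · have := norm_pos_iff.2 hne
    positivity
  · have h₄ := S.norm_L_sq_le l
    have h₅ : 0 < ‖S.L l‖ ^ 2 := by have := norm_pos_iff.2 hne; positivity
    have h₆ : 0 < ⟪S.L l, l⟫_ℝ := by
      by_contra! hcon
      have : (‖S.L‖ + 1) * ⟪S.L l, l⟫_ℝ ≤ 0 := mul_nonpos_of_nonneg_of_nonpos (by positivity) hcon
      linarith
    positivity

/-- Otherwise the trajectory would remain, from T on, in a compact set where the strict Lyapunov
function decreases at a rate at least δ > 0, although that function is bounded there. -/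
theorem exists_norm_field_lt {Q : H →L[ℝ] H} (hQ : ∀ u, S.L (Q (S.L u)) = S.L u)
    {e : E × H × H} (he : S.field e = 0) {s : ℝ → E × H × H}
    (hs : ∀ t, 0 ≤ t → HasDerivWithinAt s (S.field (s t)) (Set.Ici 0) t)
    (h0 : S.L (Q ((s 0).2.2 - e.2.2)) = (s 0).2.2 - e.2.2) {R : ℝ}
    (hR : ∀ t, 0 ≤ t → s t ∈ Metric.closedBall e R) {ε : ℝ} (hε : 0 < ε) {T : ℝ} (hT : 0 ≤ T) :
    ∃ t, T ≤ t ∧ ‖S.field (s t)‖ < ε := by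
  have : ProperSpace (E × H × H) := FiniteDimensional.proper ℝ _
  by_contra! hcon
  have hball : IsCompact (Metric.closedBall e R) := isCompact_closedBall e R
  have hC : IsCompact (Metric.closedBall e R ∩ {x | ε ≤ ‖S.field x‖}) :=
    hball.inter_right (isClosed_le continuous_const S.continuous_field.norm)
  obtain ⟨K, δ, hδ, hKδ⟩ := hC.exists_pos_le_mul_add (S.continuous_dissipation e)
    (S.continuous_crossRate e) (fun x _ => S.dissipation_nonneg e x)
    (fun x hx hd => S.crossRate_pos he hd fun h => by
      have := hx.2
      simp only [Set.mem_ofPred_eq, h, norm_zero] at this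
      linarith)
  let W : E × H × H → ℝ := fun x =>
    K * S.lyapunov Q e x + ⟪S.residual x, x.2.1 - e.2.1⟫_ℝ
  have hW : Continuous W := by
    have h₁ := S.continuous_lyapunov Q e
    have h₂ := S.continuous_residual
    fun_prop
  obtain ⟨B, hB⟩ := hball.exists_bound_of_continuousOn hW.continuousOn
  have hanti : AntitoneOn (fun t => W (s t) + δ * t) (Set.Ici T) := by
    refine antitoneOn_Ici_of_hasDerivWithinAt_nonpos (f' := fun t =>
      K * (-(1 * S.dissipation e (s t))) + -S.crossRate e (s t) + δ * 1)
      (fun t ht => ?_) (fun t ht => ?_)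
    · have ht0 := hT.trans ht
      have hst := hs t ht0
      have hst' : HasDerivWithinAt s ((1 : ℝ) • S.field (s t)) (Set.Ici 0) t := by
        rwa [one_smul]
      have hz := S.sub_mem_range_of_trajectory hQ e.2.2 (c := fun _ => 1)
        (fun t ht => by rw [one_smul]; exact hs t ht) h0 t ht0
      have h₁ := (S.hasDerivWithinAt_lyapunov hQ he hst' hz).const_mul K
      have h₂ := S.hasDerivWithinAt_cross e hst
      exact ((h₁.add h₂).add ((hasDerivWithinAt_id t _).const_mul δ)).mono
        (Set.Ici_subset_Ici.2 hT)
    · have := hKδ (s t) ⟨hR t (hT.trans ht), hcon t ht⟩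
      linarith
  have hBt := fun t ht => abs_le.1 (hB (s t) (hR t ht))
  have hB0 := (hBt T hT)
  -- Over a time (2B + 1)/δ the function W would drop by at least 2B + 1, but its values on the ball
  -- lie in [-B, B].
  have hbig : T ≤ T + (2 * B + 1) / δ := by
    have : 0 ≤ B := by linarith [hB0.1, hB0.2]
    have : 0 ≤ (2 * B + 1) / δ := by positivity
    linarith
  have h₁ := hanti (Set.mem_Ici.2 le_rfl) (Set.mem_Ici.2 hbig) hbig
  have h₂ := hBt _ (hT.trans hbig)
  have h₃ : δ * (T + (2 * B + 1) / δ) = δ * T + (2 * B + 1) := by field_simp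
  simp only [h₃] at h₁
  linarith [hB0.2, h₂.1]

/-- Boundedness and times at which the field tends to 0 give an equilibrium e' as a limit point.
Monotonicity of the Lyapunov function based at e' upgrades subsequential convergence to convergence.
-/
theorem exists_tendsto_equilibrium {Q : H →L[ℝ] H} (hQ : ∀ u, S.L (Q (S.L u)) = S.L u)
    {e : E × H × H} (he : S.field e = 0) {s : ℝ → E × H × H}
    (hs : ∀ t, 0 ≤ t → HasDerivWithinAt s (S.field (s t)) (Set.Ici 0) t)
    (h0 : S.L (Q ((s 0).2.2 - e.2.2)) = (s 0).2.2 - e.2.2) :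
    ∃ e' : E × H × H, S.field e' = 0 ∧ S.L (Q (e'.2.2 - e.2.2)) = e'.2.2 - e.2.2 ∧
      Tendsto s atTop (𝓝 e') := by
  have : ProperSpace (E × H × H) := FiniteDimensional.proper ℝ _
  have hs' : ∀ t, 0 ≤ t → HasDerivWithinAt s ((fun _ => (1 : ℝ)) t • S.field (s t))
      (Set.Ici 0) t := fun t ht => by rw [one_smul]; exact hs t ht
  obtain ⟨D, hD⟩ := S.exists_norm_sub_le_sqrt_lyapunov Q
  have hz := S.sub_mem_range_of_trajectory hQ e.2.2 hs' h0
  have hanti := S.antitoneOn_lyapunov hQ he (fun _ => zero_le_one) hs' h0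
  have hR : ∀ t, 0 ≤ t → s t ∈ Metric.closedBall e (|D| * √(S.lyapunov Q e (s 0))) := by
    intro t ht
    rw [Metric.mem_closedBall, dist_eq_norm]
    refine (hD e (s t) (hz t ht)).2.trans ?_
    gcongr
    · exact le_abs_self D
    · exact hanti (Set.mem_Ici.2 le_rfl) ht ht
  have hseq : ∀ k : ℕ, ∃ t, (k : ℝ) ≤ t ∧ ‖S.field (s t)‖ < 1 / ((k : ℝ) + 1) := fun k =>
    S.exists_norm_field_lt hQ he hs h0 hR Nat.one_div_pos_of_nat (Nat.cast_nonneg k)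
  choose τ hτk hτ using hseq
  have hτ0 : ∀ k, 0 ≤ τ k := fun k => (Nat.cast_nonneg k).trans (hτk k)
  obtain ⟨e', -, φ, hφ, hlim⟩ := (isCompact_closedBall e _).tendsto_subseq
    (fun k => hR (τ k) (hτ0 k))
  have he' : S.field e' = 0 := by
    have h₁ : Tendsto (fun k => S.field (s (τ (φ k)))) atTop (𝓝 (S.field e')) :=
      (S.continuous_field.tendsto e').comp hlim
    have h₂ : Tendsto (fun k => S.field (s (τ k))) atTop (𝓝 0) :=
      squeeze_zero_norm (fun k => (hτ k).le) tendsto_one_div_add_atTop_nhds_zero_nat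
    exact tendsto_nhds_unique h₁ (h₂.comp hφ.tendsto_atTop)
  have hze' : S.L (Q (e'.2.2 - e.2.2)) = e'.2.2 - e.2.2 := by
    have hcl : IsClosed {x : E × H × H | S.L (Q (x.2.2 - e.2.2)) = x.2.2 - e.2.2} :=
      isClosed_eq (by fun_prop) (by fun_prop)
    exact hcl.mem_of_tendsto hlim (Eventually.of_forall fun k => hz _ (hτ0 _))
  refine ⟨e', he', hze', ?_⟩
  -- Membership in range L passes from differences with e to differences with e', so the Lyapunov
  -- function may be recentred.
  have hdiff : ∀ t, 0 ≤ t → S.L (Q ((s t).2.2 - e'.2.2)) = (s t).2.2 - e'.2.2 := by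
    intro t ht
    have : (s t).2.2 - e'.2.2 = ((s t).2.2 - e.2.2) - (e'.2.2 - e.2.2) := by abel
    rw [this, map_sub, map_sub, hz t ht, hze']
  have hanti' := S.antitoneOn_lyapunov hQ he' (fun _ => zero_le_one) hs' (hdiff 0 le_rfl)
  have hV : Tendsto (fun t => S.lyapunov Q e' (s t)) atTop (𝓝 0) := by
    have hsub : Tendsto (fun k => S.lyapunov Q e' (s (τ (φ k)))) atTop (𝓝 0) := by
      have := ((S.continuous_lyapunov Q e').tendsto e').comp hlim
      rwa [lyapunov_self] at this
    rw [Metric.tendsto_atTop] at hsub ⊢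
    intro ε hε
    obtain ⟨N, hN⟩ := hsub ε hε
    refine ⟨τ (φ N), fun t ht => ?_⟩
    have ht0 := (hτ0 _).trans ht
    have h₁ := hN N le_rfl
    have h₂ := hanti' (hτ0 (φ N)) ht0 ht
    rw [dist_zero_right, Real.norm_of_nonneg (hD e' _ (hdiff _ (hτ0 _))).1] at h₁
    rw [dist_zero_right, Real.norm_of_nonneg (hD e' _ (hdiff _ ht0)).1]
    exact h₂.trans_lt h₁
  rw [tendsto_iff_norm_sub_tendsto_zero]
  have hlim0 : Tendsto (fun t => D * √(S.lyapunov Q e' (s t))) atTop (𝓝 0) := by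
    have := (hV.sqrt).const_mul D
    rwa [Real.sqrt_zero, mul_zero] at this
  refine squeeze_zero' (Eventually.of_forall fun _ => norm_nonneg _) ?_ hlim0
  filter_upwards [eventually_ge_atTop 0] with t ht using (hD e' _ (hdiff t ht)).2

/-- The Lyapunov function also decreases along the cutoff dynamics, so their solution stays in the
ball where the cutoff equals 1 and hence solves the original equation. -/
theorem exists_solution {Q : H →L[ℝ] H} (hQ : ∀ u, S.L (Q (S.L u)) = S.L u)
    {e : E × H × H} (he : S.field e = 0) {s₀ : E × H × H}
    (h0 : S.L (Q (s₀.2.2 - e.2.2)) = s₀.2.2 - e.2.2) :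
    ∃ s : ℝ → E × H × H, s 0 = s₀ ∧
      ∀ t, 0 ≤ t → HasDerivWithinAt s (S.field (s t)) (Set.Ici 0) t := by
  obtain ⟨D, hD⟩ := S.exists_norm_sub_le_sqrt_lyapunov Q
  obtain ⟨φ, s, hφ0, hφ1, hs0, hs⟩ := exists_cutoff_solution S.locallyLipschitz_field
    (‖e‖ + |D| * √(S.lyapunov Q e s₀)) s₀
  have h0' : S.L (Q ((s 0).2.2 - e.2.2)) = (s 0).2.2 - e.2.2 := by rwa [hs0]
  have hz := S.sub_mem_range_of_trajectory hQ e.2.2 (c := fun t => φ (s t)) hs h0'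
  have hanti := S.antitoneOn_lyapunov hQ he (c := fun t => φ (s t)) (fun _ => hφ0 _) hs h0'
  refine ⟨s, hs0, fun t ht => ?_⟩
  have h₁ := hs t ht
  rwa [hφ1, one_smul] at h₁
  have h₂ : ‖s t - e‖ ≤ |D| * √(S.lyapunov Q e s₀) := by
    refine (hD e (s t) (hz t ht)).2.trans ?_
    gcongr
    · exact le_abs_self D
    · have := hanti (Set.mem_Ici.2 le_rfl) ht ht
      simpa only [hs0] using this
  have h₃ := norm_sub_norm_le (s t) e
  linarith

end PrimalDualSystem

end

/-! ### Transport between the stacked and the product state spaces -/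

noncomputable section

open scoped InnerProductSpace

theorem LocallyLipschitz.pi_apply {X ι : Type*} [Fintype ι] {Y : ι → Type*}
    [PseudoEMetricSpace X] [∀ i, PseudoEMetricSpace (Y i)] {F : ∀ i, X → Y i}
    (hF : ∀ i, LocallyLipschitz (F i)) : LocallyLipschitz fun x i => F i x := by
  intro x
  choose K U hU h using fun i => hF i x
  refine ⟨∑ i, K i, ⋂ i, U i, Filter.iInter_mem.2 hU, fun y hy z hz => ?_⟩
  rw [edist_pi_le_iff]
  intro i
  refine (h i (Set.mem_iInter.1 hy i) (Set.mem_iInter.1 hz i)).trans ?_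
  gcongr
  exact Finset.single_le_sum (f := K) (fun _ _ => zero_le) (Finset.mem_univ i)

theorem HasDerivWithinAt.conj_continuousLinearEquiv {V W : Type*} [NormedAddCommGroup V]
    [NormedSpace ℝ V] [NormedAddCommGroup W] [NormedSpace ℝ W] {U : V ≃L[ℝ] W} {F : V → V}
    {F' : W → W} {s : ℝ → V} {D : Set ℝ} {t : ℝ} (hs : HasDerivWithinAt s (F (s t)) D t)
    (hF : ∀ v, F' (U v) = U (F v)) :
    HasDerivWithinAt (fun τ => U (s τ)) (F' (U (s t))) D t := by
  rw [hF]
  exact U.hasFDerivAt.comp_hasDerivWithinAt t hs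

theorem PrimalDualSystem.exists_tendsto_equilibrium_conj {E H W : Type*} [NormedAddCommGroup E]
    [InnerProductSpace ℝ E] [FiniteDimensional ℝ E] [NormedAddCommGroup H] [InnerProductSpace ℝ H]
    [FiniteDimensional ℝ H] [NormedAddCommGroup W] [NormedSpace ℝ W] (S : PrimalDualSystem E H)
    {Q : H →L[ℝ] H} (hQ : ∀ u, S.L (Q (S.L u)) = S.L u) {e : E × H × H} (he : S.field e = 0)
    {U : (E × H × H) ≃L[ℝ] W} {F : W → W} (hF : ∀ v, F (U v) = U (S.field v)) {s : ℝ → W}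
    (hs : ∀ t, 0 ≤ t → HasDerivWithinAt s (F (s t)) (Set.Ici 0) t)
    (h0 : S.L (Q ((U.symm (s 0)).2.2 - e.2.2)) = (U.symm (s 0)).2.2 - e.2.2) :
    ∃ e' : E × H × H, S.field e' = 0 ∧ S.L (Q (e'.2.2 - e.2.2)) = e'.2.2 - e.2.2 ∧
      Tendsto s atTop (𝓝 (U e')) := by
  obtain ⟨e', he', hze', hlim⟩ := S.exists_tendsto_equilibrium hQ he
    (fun t ht => (hs t ht).conj_continuousLinearEquiv (U := U.symm) fun w =>
      U.injective (by rw [← hF, U.apply_symm_apply, U.apply_symm_apply])) h0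
  refine ⟨e', he', hze', ?_⟩
  have := (U.continuous.tendsto e').comp hlim
  simpa only [Function.comp_def, U.apply_symm_apply] using this

/-! ### Gradients of convex functions -/

section Convex

variable {V : Type*} [NormedAddCommGroup V] [InnerProductSpace ℝ V] [CompleteSpace V] {f : V → ℝ}

theorem DifferentiableAt.hasDerivAt_line {x : V} (hf : DifferentiableAt ℝ f x) (v : V) :
    HasDerivAt (fun t : ℝ => f (x + t • v)) ⟪gradient f x, v⟫_ℝ 0 := by
  have hline : HasDerivAt (fun t : ℝ => x + t • v) v 0 := by
    simpa using ((hasDerivAt_id (0 : ℝ)).smul_const v).const_add x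
  have hf' : HasFDerivAt f (InnerProductSpace.toDual ℝ V (gradient f x)) (x + (0 : ℝ) • v) := by
    rw [zero_smul, add_zero]
    exact hf.hasGradientAt.hasFDerivAt
  exact hf'.comp_hasDerivAt (0 : ℝ) hline

theorem ConvexOn.add_inner_gradient_le (hc : ConvexOn ℝ Set.univ f) (hf : Differentiable ℝ f)
    (x y : V) : f x + ⟪gradient f x, y - x⟫_ℝ ≤ f y := by
  have hline : ConvexOn ℝ Set.univ fun t : ℝ => f (x + t • (y - x)) := by
    have h := hc.comp_affineMap (AffineMap.lineMap x y : ℝ →ᵃ[ℝ] V)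
    rw [Set.preimage_univ] at h
    refine h.congr fun t _ => ?_
    simp [AffineMap.lineMap_apply, add_comm]
  have h := hline.le_slope_of_hasDerivAt (Set.mem_univ 0) (Set.mem_univ 1) one_pos
    ((hf x).hasDerivAt_line (y - x))
  simp only [slope_def_field, one_smul, zero_smul, add_zero, sub_zero, div_one,
    add_sub_cancel] at h
  linarith

theorem ConvexOn.inner_gradient_sub_nonneg (hc : ConvexOn ℝ Set.univ f)
    (hf : Differentiable ℝ f) (x y : V) : 0 ≤ ⟪gradient f x - gradient f y, x - y⟫_ℝ := by
  have h₁ := hc.add_inner_gradient_le hf x y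
  have h₂ := hc.add_inner_gradient_le hf y x
  rw [← neg_sub x y, inner_neg_right] at h₁
  rw [inner_sub_left]
  linarith

/-- Equality in the monotonicity inequality makes x a minimizer of the tilted function f - ⟨∇f y,
·⟩, so the gradient of that function vanishes at x. No Lipschitz bound on the gradient is involved.
-/
theorem ConvexOn.gradient_eq_of_inner_eq_zero (hc : ConvexOn ℝ Set.univ f)
    (hf : Differentiable ℝ f) {x y : V} (h : ⟪gradient f x - gradient f y, x - y⟫_ℝ = 0) :
    gradient f x = gradient f y := by
  have h₁ := hc.add_inner_gradient_le hf x y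
  rw [← neg_sub x y, inner_neg_right] at h₁
  rw [inner_sub_left] at h
  have hmin : IsLocalMin (fun w => f w - ⟪gradient f y, w⟫_ℝ) x := by
    refine Eventually.of_forall fun w => ?_
    have h₂ := hc.add_inner_gradient_le hf y w
    rw [inner_sub_right] at h h₂ h₁
    rw [inner_sub_right] at h
    dsimp only
    linarith
  have hd : HasFDerivAt (fun w => f w - ⟪gradient f y, w⟫_ℝ)
      (InnerProductSpace.toDual ℝ V (gradient f x) - innerSL ℝ (gradient f y)) x :=
    (hf x).hasGradientAt.hasFDerivAt.sub (innerSL ℝ (gradient f y)).hasFDerivAt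
  have h0 := hmin.hasFDerivAt_eq_zero hd
  refine ext_inner_right ℝ fun v => ?_
  have := DFunLike.congr_fun h0 v
  simpa [sub_eq_zero] using this

end Convex

theorem PiLp.inner_euc_apply {n : ℕ} {d : Fin n → ℕ} (x y : PiLp 2 fun i => Euc (d i)) :
    ⟪x, y⟫_ℝ = ∑ i, ⟪x i, y i⟫_ℝ :=
  PiLp.inner_apply x y

theorem Matrix.inner_toEuclideanLin_transpose {m k : ℕ} (M : Matrix (Fin m) (Fin k) ℝ)
    (x : Euc k) (v : Euc m) :
    ⟪x, M.transpose.toEuclideanLin v⟫_ℝ = ⟪M.toEuclideanLin x, v⟫_ℝ := by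
  rw [← Matrix.conjTranspose_eq_transpose_of_trivial, Matrix.toEuclideanLin_conjTranspose_eq_adjoint,
    LinearMap.adjoint_inner_right]

/-! ### The Laplacian of a connected undirected graph -/

namespace WeightedDigraph

variable {n p : ℕ} (G : WeightedDigraph n)

theorem sum_laplacian_smul {V : Type*} [AddCommGroup V] [Module ℝ V] (u : Fin n → V) (i : Fin n) :
    ∑ j, G.laplacian i j • u j = ∑ j, G.weight i j • (u i - u j) := by
  simp only [laplacian, Matrix.sub_apply, Matrix.diagonal_apply, sub_smul, ite_smul, zero_smul,
    Finset.sum_sub_distrib, smul_sub, Finset.sum_ite_eq, Finset.mem_univ, if_true, Finset.sum_smul]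

theorem laplacian_symm {G : WeightedDigraph n} (hG : G.Undirected) (i j : Fin n) :
    G.laplacian i j = G.laplacian j i := by
  rcases eq_or_ne i j with rfl | h
  · rfl
  · simp [laplacian, h, h.symm, hG i j]

/-- The Laplacian acting on stacked vectors. -/
def laplacianMap (p : ℕ) :
    PiLp 2 (fun _ : Fin n => Euc p) →L[ℝ] PiLp 2 (fun _ : Fin n => Euc p) :=
  (PiLp.continuousLinearEquiv 2 ℝ fun _ : Fin n => Euc p).symm.toContinuousLinearMap.comp
    (ContinuousLinearMap.pi fun i => ∑ j, G.laplacian i j • PiLp.proj 2 (fun _ => Euc p) j)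

theorem laplacianMap_apply (u : PiLp 2 (fun _ : Fin n => Euc p)) (i : Fin n) :
    G.laplacianMap p u i = ∑ j, G.laplacian i j • u j := by
  simp [laplacianMap]

variable {G}

theorem laplacianMap_symm (hG : G.Undirected) (u v : PiLp 2 (fun _ : Fin n => Euc p)) :
    ⟪G.laplacianMap p u, v⟫_ℝ = ⟪u, G.laplacianMap p v⟫_ℝ := by
  simp only [PiLp.inner_euc_apply, laplacianMap_apply, sum_inner, inner_sum, inner_smul_left,
    inner_smul_right, conj_trivial]
  rw [Finset.sum_comm]
  exact Finset.sum_congr rfl fun i _ => Finset.sum_congr rfl fun j _ => by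
    rw [laplacian_symm hG]

/-- Average the double sum with its copy under exchange of i and j, which symmetry of the weights
permits. -/
theorem inner_laplacianMap_self (hG : G.Undirected) (u : PiLp 2 (fun _ : Fin n => Euc p)) :
    ⟪G.laplacianMap p u, u⟫_ℝ = 2⁻¹ * ∑ i, ∑ j, G.weight i j * ‖u i - u j‖ ^ 2 := by
  have h₁ : ⟪G.laplacianMap p u, u⟫_ℝ = ∑ i, ∑ j, G.weight i j * ⟪u i - u j, u i⟫_ℝ := by
    simp only [PiLp.inner_euc_apply, laplacianMap_apply, sum_laplacian_smul, sum_inner,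
      inner_smul_left, conj_trivial]
  have h₂ : ⟪G.laplacianMap p u, u⟫_ℝ = ∑ i, ∑ j, G.weight i j * ⟪u j - u i, u j⟫_ℝ := by
    rw [h₁, Finset.sum_comm]
    exact Finset.sum_congr rfl fun i _ => Finset.sum_congr rfl fun j _ => by rw [hG]
  have h₃ : ∑ i, ∑ j, G.weight i j * ‖u i - u j‖ ^ 2 =
      (∑ i, ∑ j, G.weight i j * ⟪u i - u j, u i⟫_ℝ) +
        ∑ i, ∑ j, G.weight i j * ⟪u j - u i, u j⟫_ℝ := by
    simp only [← Finset.sum_add_distrib]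
    refine Finset.sum_congr rfl fun i _ => Finset.sum_congr rfl fun j _ => ?_
    rw [← real_inner_self_eq_norm_sq]
    simp only [inner_sub_left, inner_sub_right]
    ring
  rw [h₃, ← h₁, ← h₂]
  ring

theorem inner_laplacianMap_self_nonneg (hG : G.Undirected)
    (u : PiLp 2 (fun _ : Fin n => Euc p)) : 0 ≤ ⟪G.laplacianMap p u, u⟫_ℝ := by
  rw [inner_laplacianMap_self hG]
  have := G.weight_nonneg
  exact mul_nonneg (by norm_num) (Finset.sum_nonneg fun i _ => Finset.sum_nonneg fun j _ =>
    mul_nonneg (this i j) (by positivity))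

/-- The quadratic form vanishes, so u agrees across every edge; connectedness propagates this along
paths. -/
theorem eq_of_laplacianMap_eq_zero (hG : G.Undirected) (hconn : G.StronglyConnected)
    {u : PiLp 2 (fun _ : Fin n => Euc p)} (hu : G.laplacianMap p u = 0) (i j : Fin n) :
    u i = u j := by
  have h := inner_laplacianMap_self hG u
  have hnn : ∀ i j, 0 ≤ G.weight i j * ‖u i - u j‖ ^ 2 := fun i j =>
    mul_nonneg (G.weight_nonneg i j) (by positivity)
  rw [hu, inner_zero_left, eq_comm, mul_eq_zero, or_iff_right (by norm_num),
    Finset.sum_eq_zero_iff_of_nonneg fun i _ => Finset.sum_nonneg fun j _ => hnn i j] at h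
  have hedge : ∀ i j, G.IsEdge i j → u i = u j := by
    intro i j hij
    have h' := (Finset.sum_eq_zero_iff_of_nonneg fun j _ => hnn i j).1 (h i (Finset.mem_univ i)) j
      (Finset.mem_univ j)
    have hij' : G.weight i j ≠ 0 := ne_of_gt hij
    simpa [hij', sub_eq_zero] using h'
  induction hconn i j with
  | refl => rfl
  | tail _ hbc ih => exact ih.trans (hedge _ _ hbc)

theorem laplacianMap_const (v : Euc p) :
    G.laplacianMap p (WithLp.toLp 2 fun _ => v) = 0 := by
  ext i : 1
  rw [laplacianMap_apply, sum_laplacian_smul]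
  simp

theorem sum_laplacianMap (hG : G.Undirected) (u : PiLp 2 (fun _ : Fin n => Euc p)) :
    ∑ i, G.laplacianMap p u i = 0 := by
  refine ext_inner_right ℝ fun v => ?_
  have h := laplacianMap_symm hG u (WithLp.toLp 2 fun _ => v)
  rw [laplacianMap_const, inner_zero_right, PiLp.inner_euc_apply] at h
  rw [sum_inner, inner_zero_left]
  exact h

theorem inner_eq_zero_of_laplacianMap_eq_zero (hG : G.Undirected) (hconn : G.StronglyConnected)
    {u z : PiLp 2 (fun _ : Fin n => Euc p)} (hu : G.laplacianMap p u = 0) (hz : ∑ i, z i = 0) :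
    ⟪u, z⟫_ℝ = 0 := by
  rw [PiLp.inner_euc_apply]
  rcases isEmpty_or_nonempty (Fin n) with h | ⟨⟨i₀⟩⟩
  · simp
  · rw [Finset.sum_congr rfl fun i _ => by rw [eq_of_laplacianMap_eq_zero hG hconn hu i i₀],
      ← inner_sum, hz, inner_zero_right]

/-- L is self-adjoint, so its range is the orthogonal complement of its kernel. The kernel consists
of consensus vectors, to which every zero-sum vector is orthogonal. -/
theorem exists_laplacianMap_eq (hG : G.Undirected) (hconn : G.StronglyConnected)
    {z : PiLp 2 (fun _ : Fin n => Euc p)} (hz : ∑ i, z i = 0) :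
    ∃ y, G.laplacianMap p y = z := by
  have hadj : LinearMap.adjoint (G.laplacianMap p).toLinearMap = (G.laplacianMap p).toLinearMap := by
    rw [eq_comm, LinearMap.eq_adjoint_iff]
    exact laplacianMap_symm hG
  have hmem : z ∈ (LinearMap.ker (G.laplacianMap p).toLinearMap)ᗮ := by
    rw [Submodule.mem_orthogonal]
    exact fun u hu => inner_eq_zero_of_laplacianMap_eq_zero hG hconn hu hz
  rw [LinearMap.orthogonal_ker, hadj] at hmem
  exact hmem

end WeightedDigraph

/-! ### IDEA as a primal-dual system -/

namespace CoupledProblem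

variable {n p : ℕ} {d : Fin n → ℕ} (P : CoupledProblem n p d)

/-- The stacked gradient. -/
def stackedGradient (x : PiLp 2 fun i => Euc (d i)) : PiLp 2 fun i => Euc (d i) :=
  WithLp.toLp 2 fun i => gradient (P.f i) (x i)

/-- The block diagonal constraint map. -/
def blockMap : PiLp 2 (fun i => Euc (d i)) →L[ℝ] PiLp 2 (fun _ : Fin n => Euc p) :=
  (PiLp.continuousLinearEquiv 2 ℝ fun _ : Fin n => Euc p).symm.toContinuousLinearMap.comp
    (ContinuousLinearMap.pi fun i => (P.A i).toEuclideanLin.toContinuousLinearMap.comp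
      (PiLp.proj 2 (fun i => Euc (d i)) i))

theorem blockMap_apply (x : PiLp 2 fun i => Euc (d i)) (i : Fin n) :
    P.blockMap x i = (P.A i).toEuclideanLin (x i) := rfl

theorem locallyLipschitz_stackedGradient (hlip : ∀ i, LocallyLipschitz (gradient (P.f i))) :
    LocallyLipschitz P.stackedGradient := by
  have hpi : LocallyLipschitz fun (x : PiLp 2 fun i => Euc (d i)) i => gradient (P.f i) (x i) :=
    LocallyLipschitz.pi_apply fun i => (hlip i).comp
      (PiLp.proj 2 (𝕜 := ℝ) (fun i => Euc (d i)) i).lipschitz.locallyLipschitz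
  exact (PiLp.continuousLinearEquiv 2 ℝ fun i => Euc (d i)).symm.lipschitz.locallyLipschitz.comp hpi

/-- The dynamics IDEA on the stacked Euclidean spaces. -/
def toPrimalDualSystem (hconvex : ∀ i, ConvexOn ℝ Set.univ (P.f i))
    (hdiff : ∀ i, Differentiable ℝ (P.f i)) (hlip : ∀ i, LocallyLipschitz (gradient (P.f i)))
    {G : WeightedDigraph n} (hG : G.Undirected) (bs : Fin n → Euc p) {α β : ℝ} (hα : 0 < α)
    (hβ : 0 < β) :
    PrimalDualSystem (PiLp 2 fun i => Euc (d i)) (PiLp 2 fun _ : Fin n => Euc p) where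
  g := P.stackedGradient
  A := P.blockMap
  L := G.laplacianMap p
  b := WithLp.toLp 2 bs
  α := α
  β := β
  locallyLipschitz_g := P.locallyLipschitz_stackedGradient hlip
  monotone_g x y := by
    rw [PiLp.inner_euc_apply]
    exact Finset.sum_nonneg fun i _ => (hconvex i).inner_gradient_sub_nonneg (hdiff i) (x i) (y i)
  eq_of_inner_eq_zero x y h := by
    have h' : ∑ i, ⟪gradient (P.f i) (x i) - gradient (P.f i) (y i), x i - y i⟫_ℝ = 0 := by
      rw [PiLp.inner_euc_apply] at h
      exact h
    rw [Finset.sum_eq_zero_iff_of_nonneg fun i _ =>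
      (hconvex i).inner_gradient_sub_nonneg (hdiff i) (x i) (y i)] at h'
    ext i : 1
    exact (hconvex i).gradient_eq_of_inner_eq_zero (hdiff i) (h' i (Finset.mem_univ i))
  symm_L := G.laplacianMap_symm hG
  nonneg_L := G.inner_laplacianMap_self_nonneg hG
  α_pos := hα
  β_pos := hβ

theorem inner_blockMap (x : PiLp 2 fun i => Euc (d i)) (v : PiLp 2 fun _ : Fin n => Euc p) :
    ⟪P.blockMap x, v⟫_ℝ =
      ⟪x, WithLp.toLp 2 fun i => (P.A i).transpose.toEuclideanLin (v i)⟫_ℝ := by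
  simp only [PiLp.inner_euc_apply, blockMap_apply, Matrix.inner_toEuclideanLin_transpose]

variable (n p d) in
/-- The identification of the stacked Euclidean state space with the state space of IDEA. -/
def unstack : ((PiLp 2 fun i => Euc (d i)) × (PiLp 2 fun _ : Fin n => Euc p) ×
    (PiLp 2 fun _ : Fin n => Euc p)) ≃L[ℝ] IDEAState n p d :=
  (PiLp.continuousLinearEquiv 2 ℝ fun i => Euc (d i)).prodCongr
    ((PiLp.continuousLinearEquiv 2 ℝ fun _ : Fin n => Euc p).prodCongr
      (PiLp.continuousLinearEquiv 2 ℝ fun _ : Fin n => Euc p))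

section Stacked

variable (hconvex : ∀ i, ConvexOn ℝ Set.univ (P.f i)) (hdiff : ∀ i, Differentiable ℝ (P.f i))
  (hlip : ∀ i, LocallyLipschitz (gradient (P.f i))) {G : WeightedDigraph n} (hG : G.Undirected)
  (bs : Fin n → Euc p) {α β : ℝ} (hα : 0 < α) (hβ : 0 < β)

theorem residual_apply (s) (i : Fin n) :
    (P.toPrimalDualSystem hconvex hdiff hlip hG bs hα hβ).residual s i =
      (P.A i).toEuclideanLin (s.1 i) - bs i - s.2.2 i := rfl

theorem At_apply (v : PiLp 2 fun _ : Fin n => Euc p) (i : Fin n) :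
    (P.toPrimalDualSystem hconvex hdiff hlip hG bs hα hβ).At v i =
      (P.A i).transpose.toEuclideanLin (v i) := by
  have h : (P.toPrimalDualSystem hconvex hdiff hlip hG bs hα hβ).At v =
      WithLp.toLp 2 fun i => (P.A i).transpose.toEuclideanLin (v i) := by
    refine ext_inner_left ℝ fun x => ?_
    rw [PrimalDualSystem.inner_At_right]
    exact P.inner_blockMap x v
  rw [h]

theorem ideaField_unstack (s) :
    P.ideaField G bs α β (unstack n p d s) = unstack n p d
      ((P.toPrimalDualSystem hconvex hdiff hlip hG bs hα hβ).field s) := by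
  refine Prod.ext (funext fun i => ?_) (Prod.ext (funext fun i => ?_) (funext fun i => ?_))
  · change _ = -(α • (gradient (P.f i) (s.1 i) +
      (P.toPrimalDualSystem hconvex hdiff hlip hG bs hα hβ).At s.2.1 i)) -
      (P.toPrimalDualSystem hconvex hdiff hlip hG bs hα hβ).At
        ((P.toPrimalDualSystem hconvex hdiff hlip hG bs hα hβ).residual s) i
    rw [At_apply, At_apply, residual_apply]
    rfl
  · change _ = (P.A i).toEuclideanLin (s.1 i) - bs i - s.2.2 i - β • G.laplacianMap p s.2.1 i
    rw [G.laplacianMap_apply]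
    rfl
  · change _ = (α * β) • G.laplacianMap p s.2.1 i
    rw [G.laplacianMap_apply]
    rfl

end Stacked

/-! ### Optimality conditions and equilibria -/

/-- The Lagrange multiplier of an optimal solution. -/
theorem IsOptimal.exists_multiplier {P : CoupledProblem n p d}
    (hdiff : ∀ i, Differentiable ℝ (P.f i)) {x : ∀ i, Euc (d i)} (hx : P.IsOptimal x) :
    ∃ μ : Euc p, ∀ i, gradient (P.f i) (x i) + (P.A i).transpose.toEuclideanLin μ = 0 := by
  let B : PiLp 2 (fun i => Euc (d i)) →ₗ[ℝ] Euc p :=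
    { toFun := fun v => ∑ i, (P.A i).toEuclideanLin (v i)
      map_add' := fun u v => by simp [Finset.sum_add_distrib]
      map_smul' := fun c v => by simp [Finset.smul_sum] }
  -- Moving along a direction v in ker B keeps feasibility, so the derivative of the cost along v is
  -- zero. The gradient thus lies in the range of the adjoint of B, which yields the multiplier.
  have hmem : P.stackedGradient (WithLp.toLp 2 x) ∈ (LinearMap.ker B)ᗮ := by
    rw [Submodule.mem_orthogonal']
    intro v hv
    have hv' : ∑ i, (P.A i).toEuclideanLin (v i) = 0 := hv
    have hd : HasDerivAt (fun t : ℝ => P.cost fun i => x i + t • v i)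
        (∑ i, ⟪gradient (P.f i) (x i), v i⟫_ℝ) 0 :=
      HasDerivAt.fun_sum fun i _ => (hdiff i (x i)).hasDerivAt_line (v i)
    have hmin : IsLocalMin (fun t : ℝ => P.cost fun i => x i + t • v i) 0 := by
      refine Eventually.of_forall fun t => ?_
      simp only [zero_smul, add_zero]
      refine hx.2 _ ?_
      simp only [Feasible, map_add, map_smul, Finset.sum_add_distrib, ← Finset.smul_sum, hv',
        smul_zero, add_zero]
      exact hx.1
    rw [PiLp.inner_euc_apply]
    exact hmin.hasDerivAt_eq_zero hd
  rw [LinearMap.orthogonal_ker] at hmem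
  obtain ⟨ν, hν⟩ := hmem
  have hB : LinearMap.adjoint B ν =
      WithLp.toLp 2 fun i => (P.A i).transpose.toEuclideanLin ν := by
    refine ext_inner_left ℝ fun v => ?_
    rw [LinearMap.adjoint_inner_right]
    simp only [B, LinearMap.coe_mk, AddHom.coe_mk, sum_inner, PiLp.inner_euc_apply,
      Matrix.inner_toEuclideanLin_transpose]
  refine ⟨-ν, fun i => ?_⟩
  rw [hB] at hν
  have hi : (P.A i).transpose.toEuclideanLin ν = gradient (P.f i) (x i) := congrArg (fun w => w i) hν
  rw [map_neg, hi, add_neg_cancel]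

/-- In the first-order convexity inequality the linear term is -⟨l, A(y - x)⟩. It vanishes because l
is a consensus vector and the blocks of A(y - x) sum to zero for feasible x and y. -/
theorem isOptimal_of_gradient_eq (hconvex : ∀ i, ConvexOn ℝ Set.univ (P.f i))
    (hdiff : ∀ i, Differentiable ℝ (P.f i)) {G : WeightedDigraph n} (hG : G.Undirected)
    (hconn : G.StronglyConnected) {x : ∀ i, Euc (d i)} (hx : P.Feasible x)
    {l : PiLp 2 fun _ : Fin n => Euc p} (hl : G.laplacianMap p l = 0)
    (hgrad : ∀ i, gradient (P.f i) (x i) + (P.A i).transpose.toEuclideanLin (l i) = 0) :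
    P.IsOptimal x := by
  refine ⟨hx, fun y hy => ?_⟩
  have h₁ : P.cost x + ∑ i, ⟪gradient (P.f i) (x i), y i - x i⟫_ℝ ≤ P.cost y := by
    rw [cost, cost, ← Finset.sum_add_distrib]
    exact Finset.sum_le_sum fun i _ => (hconvex i).add_inner_gradient_le (hdiff i) _ _
  have h₂ : ⟪l, P.blockMap (WithLp.toLp 2 y - WithLp.toLp 2 x)⟫_ℝ = 0 := by
    refine G.inner_eq_zero_of_laplacianMap_eq_zero hG hconn hl ?_
    simp only [blockMap_apply, PiLp.sub_apply, map_sub, Finset.sum_sub_distrib]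
    exact sub_eq_zero.2 (hy.trans hx.symm)
  have h₃ : ∑ i, ⟪gradient (P.f i) (x i), y i - x i⟫_ℝ = 0 := by
    rw [← neg_eq_zero, ← h₂, real_inner_comm, inner_blockMap, real_inner_comm, PiLp.inner_euc_apply,
      ← Finset.sum_neg_distrib]
    refine Finset.sum_congr rfl fun i _ => ?_
    rw [eq_neg_of_add_eq_zero_left (hgrad i), inner_neg_left, neg_neg]
    rfl
  linarith

theorem IsOptimal.exists_field_eq_zero {P : CoupledProblem n p d}
    (hconvex : ∀ i, ConvexOn ℝ Set.univ (P.f i)) (hdiff : ∀ i, Differentiable ℝ (P.f i))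
    (hlip : ∀ i, LocallyLipschitz (gradient (P.f i))) {G : WeightedDigraph n} (hG : G.Undirected)
    {bs : Fin n → Euc p} (hbs : ∑ i, bs i = P.b) {α β : ℝ} (hα : 0 < α) (hβ : 0 < β)
    {x : ∀ i, Euc (d i)} (hx : P.IsOptimal x) :
    ∃ e, (P.toPrimalDualSystem hconvex hdiff hlip hG bs hα hβ).field e = 0 ∧
      ∑ i, e.2.2 i = 0 := by
  obtain ⟨μ, hμ⟩ := hx.exists_multiplier hdiff
  refine ⟨(WithLp.toLp 2 x, WithLp.toLp 2 fun _ => μ,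
    WithLp.toLp 2 fun i => (P.A i).toEuclideanLin (x i) - bs i), ?_, ?_⟩
  · rw [PrimalDualSystem.field_eq_zero_iff]
    refine ⟨?_, ?_, G.laplacianMap_const μ⟩
    · ext i : 1
      rw [PiLp.add_apply, At_apply]
      exact hμ i
    · ext i : 1
      rw [residual_apply]
      exact sub_self _
  · simp only [Finset.sum_sub_distrib, hbs]
    exact sub_eq_zero.2 hx.1

/-- Summing the residual equations turns ∑ z_i = 0 into the coupled constraint; without that
normalization an equilibrium would solve the problem with a shifted right-hand side. -/
theorem isOptimal_of_field_eq_zero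
    (hconvex : ∀ i, ConvexOn ℝ Set.univ (P.f i)) (hdiff : ∀ i, Differentiable ℝ (P.f i))
    (hlip : ∀ i, LocallyLipschitz (gradient (P.f i))) {G : WeightedDigraph n} (hG : G.Undirected)
    (hconn : G.StronglyConnected) {bs : Fin n → Euc p} (hbs : ∑ i, bs i = P.b) {α β : ℝ}
    (hα : 0 < α) (hβ : 0 < β) {e}
    (he : (P.toPrimalDualSystem hconvex hdiff hlip hG bs hα hβ).field e = 0)
    (hz : ∑ i, e.2.2 i = 0) : P.IsOptimal fun i => e.1 i := by
  obtain ⟨hg, hr, hL⟩ := (PrimalDualSystem.field_eq_zero_iff _ e).1 he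
  refine P.isOptimal_of_gradient_eq hconvex hdiff hG hconn ?_ hL fun i => ?_
  · have h : ∑ i, ((P.A i).toEuclideanLin (e.1 i) - bs i - e.2.2 i) = 0 :=
      Finset.sum_eq_zero fun i _ => by
        rw [← P.residual_apply hconvex hdiff hlip hG bs hα hβ e, hr, PiLp.zero_apply]
    rw [Finset.sum_sub_distrib, Finset.sum_sub_distrib, hz, hbs, sub_zero] at h
    exact sub_eq_zero.1 h
  · rw [← P.At_apply hconvex hdiff hlip hG bs hα hβ]
    exact congrArg (fun w => w i) hg

end CoupledProblem

end

theorem theorem1 {n p : ℕ} {d : Fin n → ℕ} (P : CoupledProblem n p d)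
    (hconvex : ∀ i, ConvexOn ℝ Set.univ (P.f i))
    (hdiff : ∀ i, Differentiable ℝ (P.f i))
    (hlip : ∀ i, LocallyLipschitz (gradient (P.f i)))
    (hsol : ∃ x, P.IsOptimal x)
    (G : WeightedDigraph n) (hundirected : G.Undirected) (hconn : G.StronglyConnected)
    (bs : Fin n → Euc p) (hbs : ∑ i, bs i = P.b)
    (α β : ℝ) (hα : 0 < α) (hβ : 0 < β)
    (x₀ : ∀ i, Euc (d i)) (lam₀ z₀ : Fin n → Euc p) (hz₀ : ∑ i, z₀ i = 0) :
    (∃ s : ℝ → IDEAState n p d, P.IsTrajectory G bs α β s ∧ s 0 = (x₀, lam₀, z₀)) ∧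
    ∀ s : ℝ → IDEAState n p d, P.IsTrajectory G bs α β s → s 0 = (x₀, lam₀, z₀) →
      ∃ (xs : ∀ i, Euc (d i)) (lams zs : Fin n → Euc p),
        P.IsEquilibrium G bs α β (xs, lams, zs) ∧
        P.IsOptimal xs ∧
        Tendsto s atTop (𝓝 (xs, lams, zs)) := by
  obtain ⟨x, hx⟩ := hsol
  obtain ⟨e, he, hesum⟩ := hx.exists_field_eq_zero hconvex hdiff hlip hundirected hbs hα hβ
  have hopt := fun e' => P.isOptimal_of_field_eq_zero hconvex hdiff hlip hundirected hconn hbs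
    hα hβ (e := e')
  have hfield := P.ideaField_unstack hconvex hdiff hlip hundirected bs hα hβ
  have hSL : (P.toPrimalDualSystem hconvex hdiff hlip hundirected bs hα hβ).L =
    G.laplacianMap p := rfl
  generalize P.toPrimalDualSystem hconvex hdiff hlip hundirected bs hα hβ = S at *
  obtain ⟨U, hU⟩ : ∃ U, U = CoupledProblem.unstack n p d := ⟨_, rfl⟩
  have hUapply : ∀ s, U s = (s.1.ofLp, s.2.1.ofLp, s.2.2.ofLp) := fun s => by rw [hU]; rfl
  rw [← hU] at hfield
  obtain ⟨Q, hQ⟩ := S.exists_generalizedInverse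
  have hrange : ∀ z : PiLp 2 (fun _ : Fin n => Euc p), ∑ i, z i = 0 → S.L (Q z) = z := by
    intro z hz
    obtain ⟨y, rfl⟩ := G.exists_laplacianMap_eq hundirected hconn hz
    rw [← hSL]
    exact hQ y
  have hs₀ : U (WithLp.toLp 2 x₀, WithLp.toLp 2 lam₀, WithLp.toLp 2 z₀) = (x₀, lam₀, z₀) :=
    hUapply _
  have h0 : S.L (Q (WithLp.toLp 2 z₀ - e.2.2)) = WithLp.toLp 2 z₀ - e.2.2 := by
    refine hrange _ ?_
    simp only [PiLp.sub_apply, Finset.sum_sub_distrib, hesum, sub_zero]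
    exact hz₀
  refine ⟨?_, fun s hs hs0 => ?_⟩
  · obtain ⟨s, hs0, hs⟩ := S.exists_solution hQ he
      (s₀ := (WithLp.toLp 2 x₀, WithLp.toLp 2 lam₀, WithLp.toLp 2 z₀)) h0
    refine ⟨fun t => U (s t), fun t ht => ?_, by dsimp only; rw [hs0, hs₀]⟩
    exact (hs t ht).conj_continuousLinearEquiv hfield
  · have hstart : U.symm (s 0) = (WithLp.toLp 2 x₀, WithLp.toLp 2 lam₀, WithLp.toLp 2 z₀) := by
      rw [hs0, ← hs₀, U.symm_apply_apply]
    obtain ⟨e', he', hze', hlim'⟩ := S.exists_tendsto_equilibrium_conj hQ he hfield hs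
      (by rw [hstart]; exact h0)
    have heq : P.ideaField G bs α β (U e') = 0 := by rw [hfield, he', map_zero]
    -- The limit z differs from that of e by an element of range L, whose blocks sum to zero.
    have hzs : ∑ i, e'.2.2 i = 0 := by
      have h := G.sum_laplacianMap hundirected (Q (e'.2.2 - e.2.2))
      rw [← hSL, hze'] at h
      simpa only [PiLp.sub_apply, Finset.sum_sub_distrib, hesum, sub_zero] using h
    rw [hUapply] at heq hlim'
    exact ⟨_, _, _, heq, hopt e' he' hzs, hlim'⟩
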